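/- Let $N, m$ be natural numbers, let $\Omega\subset\mathbb{R}^N$ be a domain, i.e. a connected open set, let $q\in[1,\infty)$ be a real number and let $u\in L^q(\Omega,\mathbb{R}^m)$. Write $|\cdot|$ for the Euclidean norm and $\mathcal{L}^{2N}$ for Lebesgue measure on $\mathbb{R}^N\times\mathbb{R}^N$. If $$\lim_{s\to+\infty} s\,\mathcal{L}^{2N}\Big(\Big\{(x,y)\in\Omega\times\Omega : \frac{|u(y)-u(x)|^q}{|y-x|^{q+N}}>s\Big\}\Big)=0,$$ then $u$ is almost everywhere equal to a constant on $\Omega$: there is $c\in\mathbb{R}^m$ such that $u(x)=c$ for almost every $x\in\Omega$. -/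

import Mathlib

open Filter MeasureTheory Topology
open Module (finrank)
open scoped ENNReal NNReal

/-!
Put `f (x, y) = (min 1 |u y - u x|) ^ q / |y - x| ^ (q + N)` for `x`, `y` in a ball, and let `I k`
be the integral of `f` over the pairs at distance in `[2 ^ k, 2 ^ (k + 1))`. If `z` is the midpoint
of `x` and `y`, convexity of `t ↦ t ^ q` gives `f (x, y) ≤ 2 ^ (-N - 1) * (f (x, z) + f (y, z))`,
and `y ↦ z` has Jacobian `2 ^ (-N)`; the powers of two cancel exactly and `I k ≤ I (k - 1)`. So the
`K` shells `k, k - 1, …, k - K + 1` together carry at least `K * I k`, and `f ≤ C * b ^ K` on all of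
them because of the truncation: `K * I k ≤ ∫_{f ≤ C * b ^ K} f`. If `s * |{f > s}| → 0` as `s → ∞`,
the layer `{C * b ^ j < f ≤ C * b ^ (j + 1)}` contributes `o(1)` as `j → ∞` to the right-hand side,
which is therefore `o(K)`. Hence `I k = 0` for all `k`, and `u` is constant on the ball.
-/

section WeakType

theorem tendsto_sum_range_div_nat_zero {ε : ℕ → ℝ≥0∞} (hε_ne : ∀ j, ε j ≠ ∞)
    (hε : Tendsto ε atTop (𝓝 0)) :
    Tendsto (fun K : ℕ => (∑ j ∈ Finset.range K, ε j) / K) atTop (𝓝 0) := by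
  lift ε to ℕ → ℝ≥0 using hε_ne
  have hcesaro : Tendsto (fun K : ℕ => (∑ j ∈ Finset.range K, ε j) / (K : ℝ≥0)) atTop (𝓝 0) := by
    rw [← NNReal.tendsto_coe]
    have hreal := (NNReal.tendsto_coe.2 (ENNReal.tendsto_coe.1 hε)).cesaro
    simpa only [NNReal.coe_div, NNReal.coe_sum, NNReal.coe_natCast, inv_mul_eq_div] using hreal
  refine (ENNReal.tendsto_coe.2 hcesaro).congr' ?_
  filter_upwards [eventually_gt_atTop 0] with K hK
  rw [ENNReal.coe_div (by positivity), ENNReal.ofNNReal_finsetSum, ENNReal.coe_natCast]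

variable {α : Type*} [MeasurableSpace α] {ν : Measure α} {f : α → ℝ≥0∞}

theorem setLIntegral_inter_sublevel_le_mul (hf : Measurable f) (t : ℝ≥0∞) {A : Set α}
    (hA : MeasurableSet A) : ∫⁻ x in A ∩ {x | f x ≤ t}, f x ∂ν ≤ t * ν A :=
  calc ∫⁻ x in A ∩ {x | f x ≤ t}, f x ∂ν
      ≤ ∫⁻ _ in A ∩ {x | f x ≤ t}, t ∂ν :=
        setLIntegral_mono' (hA.inter (measurableSet_le hf measurable_const)) fun _ hx => hx.2
    _ = t * ν (A ∩ {x | f x ≤ t}) := setLIntegral_const _ _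
    _ ≤ t * ν A := by gcongr; exact Set.inter_subset_left

theorem setLIntegral_sublevel_le_add (hf : Measurable f) (s t : ℝ≥0∞) :
    ∫⁻ x in {x | f x ≤ t}, f x ∂ν ≤ ∫⁻ x in {x | f x ≤ s}, f x ∂ν + t * ν {x | s < f x} :=
  calc ∫⁻ x in {x | f x ≤ t}, f x ∂ν
      ≤ ∫⁻ x in {x | f x ≤ s} ∪ {x | s < f x} ∩ {x | f x ≤ t}, f x ∂ν :=
        lintegral_mono_set fun x hx => (le_or_gt (f x) s).imp_right fun hs => ⟨hs, hx⟩
    _ ≤ ∫⁻ x in {x | f x ≤ s}, f x ∂ν + ∫⁻ x in {x | s < f x} ∩ {x | f x ≤ t}, f x ∂ν :=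
        lintegral_union_le _ _ _
    _ ≤ ∫⁻ x in {x | f x ≤ s}, f x ∂ν + t * ν {x | s < f x} := by
        gcongr
        exact setLIntegral_inter_sublevel_le_mul hf t (measurableSet_lt measurable_const hf)

theorem setLIntegral_sublevel_le_add_sum (hf : Measurable f) (t : ℕ → ℝ≥0∞) (K : ℕ) :
    ∫⁻ x in {x | f x ≤ t K}, f x ∂ν ≤
      t 0 * ν Set.univ + ∑ j ∈ Finset.range K, t (j + 1) * ν {x | t j < f x} := by
  induction K with
  | zero => simpa using setLIntegral_inter_sublevel_le_mul hf (t 0) (A := Set.univ) .univ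
  | succ K ih =>
    rw [Finset.sum_range_succ, ← add_assoc]
    exact (setLIntegral_sublevel_le_add hf (t K) (t (K + 1))).trans (by gcongr)

theorem tendsto_setLIntegral_sublevel_geometric_div_nat [IsFiniteMeasure ν] (hf : Measurable f)
    (hlim : Tendsto (fun s : ℝ≥0 => s * ν {x | s < f x}) atTop (𝓝 0)) {C b : ℝ≥0} (hC : 0 < C)
    (hb : 1 < b) :
    Tendsto (fun K : ℕ => (∫⁻ x in {x | f x ≤ (C * b ^ K : ℝ≥0)}, f x ∂ν) / K) atTop (𝓝 0) := by
  set t : ℕ → ℝ≥0 := fun j => C * b ^ j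
  have ht : Tendsto t atTop atTop := (tendsto_pow_atTop_atTop_of_one_lt hb).const_mul_atTop hC
  have hlayer : Tendsto (fun j => t (j + 1) * ν {x | t j < f x}) atTop (𝓝 0) := by
    have hmul :=
      ENNReal.Tendsto.const_mul (a := (b : ℝ≥0∞)) (hlim.comp ht) (.inr ENNReal.coe_ne_top)
    rw [mul_zero] at hmul
    refine hmul.congr fun j => ?_
    simp only [t, Function.comp_apply, ENNReal.coe_mul, pow_succ]
    ring
  have hbase : Tendsto (fun K : ℕ => t 0 * ν Set.univ / K) atTop (𝓝 0) := by
    have hfin : (t 0 : ℝ≥0∞) * ν Set.univ ≠ ∞ := by finiteness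
    simpa using ENNReal.Tendsto.const_div ENNReal.tendsto_nat_nhds_top (.inr hfin)
  have hbound := hbase.add (tendsto_sum_range_div_nat_zero (fun j => by finiteness) hlayer)
  rw [add_zero] at hbound
  refine tendsto_of_tendsto_of_tendsto_of_le_of_le tendsto_const_nhds hbound
    (fun _ => zero_le) fun K => ?_
  simp only [← ENNReal.add_div]
  exact ENNReal.div_le_div_right (setLIntegral_sublevel_le_add_sum hf (fun j => t j) K) _

end WeakType

section DyadicShell

/-- The pairs of points of `B` whose distance lies in `[2 ^ k, 2 ^ (k + 1))`. Scales are indexed by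
`k : ℤ`, and `k → -∞` approaches the diagonal. -/
def dyadicShell {X : Type*} [PseudoEMetricSpace X] (B : Set X) (k : ℤ) : Set (X × X) :=
  B ×ˢ B ∩ {p | edist p.1 p.2 ∈ Set.Ico (2 ^ k) (2 ^ (k + 1))}

section EMetric

variable {X : Type*} [PseudoEMetricSpace X] {B : Set X} {k : ℤ}

theorem swap_mem_dyadicShell {p : X × X} : p.swap ∈ dyadicShell B k ↔ p ∈ dyadicShell B k := by
  simp only [dyadicShell, Set.mem_inter_iff, Set.mem_prod, Set.mem_ofPred_eq, Prod.fst_swap,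
    Prod.snd_swap, edist_comm p.2, and_comm (a := p.2 ∈ B)]

theorem pairwise_disjoint_dyadicShell (B : Set X) :
    Pairwise (Function.onFun Disjoint (dyadicShell B)) := fun i j hij => by
  have hIco := (ENNReal.monotone_zpow one_le_two).pairwise_disjoint_on_Ico_succ hij
  exact (hIco.preimage fun p : X × X => edist p.1 p.2).mono Set.inter_subset_right
    Set.inter_subset_right

theorem measurableSet_dyadicShell [MeasurableSpace X] [OpensMeasurableSpace X]
    [SecondCountableTopology X] (hB : MeasurableSet B) (k : ℤ) :
    MeasurableSet (dyadicShell B k) :=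
  (hB.prod hB).inter ((measurable_fst.edist measurable_snd) measurableSet_Ico)

end EMetric

theorem exists_mem_dyadicShell {X : Type*} [MetricSpace X] {B : Set X} {x y : X} (hx : x ∈ B)
    (hy : y ∈ B) (hxy : x ≠ y) : ∃ k, (x, y) ∈ dyadicShell B k := by
  obtain ⟨k, hk⟩ := ENNReal.exists_mem_Ico_zpow (edist_pos.2 hxy).ne' (edist_ne_top x y)
    ENNReal.one_lt_two ENNReal.ofNat_ne_top
  exact ⟨k, ⟨hx, hy⟩, hk⟩

variable {E : Type*} [SeminormedAddCommGroup E] [NormedSpace ℝ E]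

theorem edist_left_midpoint (x y : E) : edist x (midpoint ℝ x y) = edist x y / 2 := by
  rw [edist_nndist, nndist_left_midpoint, edist_nndist]
  simp [ENNReal.div_eq_inv_mul]

theorem midpoint_mem_dyadicShell {B : Set E} (hB : Convex ℝ B) {k : ℤ} {x y : E}
    (hxy : (x, y) ∈ dyadicShell B k) : (x, midpoint ℝ x y) ∈ dyadicShell B (k - 1) := by
  obtain ⟨⟨hx, hy⟩, hlower, hupper⟩ := hxy
  have hpow (i : ℤ) : (2 : ℝ≥0∞) ^ (i - 1) = 2 ^ i / 2 := by
    rw [ENNReal.zpow_sub two_ne_zero ENNReal.ofNat_ne_top, zpow_one, div_eq_mul_inv]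
  refine ⟨⟨hx, hB.midpoint_mem hx hy⟩, ?_⟩
  simp only [Set.mem_ofPred_eq, edist_left_midpoint, Set.mem_Ico]
  rw [hpow, sub_add_eq_add_sub, hpow]
  exact ⟨ENNReal.div_le_div_right hlower 2,
    ENNReal.div_lt_div_right two_ne_zero ENNReal.ofNat_ne_top hupper⟩

end DyadicShell

section TruncatedQuotient

/-- The difference quotient `|v y - v x| ^ q / |y - x| ^ r` as an extended nonnegative real, with
the increment of `v` truncated at `1` so that it is bounded on every dyadic shell without any
integrability of `v`. For `0 < q` it takes the value `0 / 0 = 0` on the diagonal. -/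
noncomputable def truncatedQuotient {X V : Type*} [PseudoEMetricSpace X] [PseudoEMetricSpace V]
    (v : X → V) (q r : ℝ) (p : X × X) : ℝ≥0∞ :=
  min 1 (edist (v p.1) (v p.2)) ^ q / edist p.1 p.2 ^ r

section EMetric

variable {X V : Type*} [PseudoEMetricSpace X] [PseudoEMetricSpace V]

theorem measurable_truncatedQuotient [MeasurableSpace X] [OpensMeasurableSpace X]
    [SecondCountableTopology X] {v : X → V} (hv : StronglyMeasurable v) (q r : ℝ) :
    Measurable (truncatedQuotient v q r) := by
  have hincr : Measurable fun p : X × X => edist (v p.1) (v p.2) :=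
    ((hv.comp_measurable measurable_fst).edist (hv.comp_measurable measurable_snd)).measurable
  unfold truncatedQuotient
  fun_prop

theorem truncatedQuotient_le_of_mem_dyadicShell (v : X → V) {q r : ℝ} (hq : 0 ≤ q) (hr : 0 ≤ r)
    {B : Set X} {k : ℤ} {p : X × X} (hp : p ∈ dyadicShell B k) :
    truncatedQuotient v q r p ≤ (2 ^ (-k)) ^ r :=
  calc truncatedQuotient v q r p ≤ 1 ^ q / (2 ^ k) ^ r := by
        unfold truncatedQuotient
        gcongr
        · exact min_le_left _ _
        · exact hp.2.1
    _ = (2 ^ (-k)) ^ r := by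
        rw [ENNReal.one_rpow, one_div, ENNReal.zpow_neg, ENNReal.inv_rpow]

end EMetric

theorem truncatedQuotient_eq_zero_iff {X V : Type*} [PseudoMetricSpace X] [EMetricSpace V]
    {v : X → V} {q r : ℝ} (hq : 0 < q) (hr : 0 ≤ r) {p : X × X} :
    truncatedQuotient v q r p = 0 ↔ v p.1 = v p.2 := by
  have hdist : edist p.1 p.2 ^ r ≠ ∞ := by finiteness
  rw [truncatedQuotient, ENNReal.div_eq_zero_iff, or_iff_left hdist,
    ENNReal.rpow_eq_zero_iff_of_pos hq]
  simp

theorem truncatedQuotient_le_ofReal {X V : Type*} [MetricSpace X] [PseudoMetricSpace V]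
    (v : X → V) {q r : ℝ} (hq : 0 < q) (hr : 0 ≤ r) (p : X × X) :
    truncatedQuotient v q r p ≤
      ENNReal.ofReal (dist (v p.1) (v p.2) ^ q / dist p.1 p.2 ^ r) := by
  rcases eq_or_ne p.1 p.2 with heq | hne
  · simp [truncatedQuotient, heq, hq]
  have hdist : 0 < dist p.1 p.2 := dist_pos.2 hne
  rw [ENNReal.ofReal_div_of_pos (by positivity), ← ENNReal.ofReal_rpow_of_nonneg dist_nonneg hq.le,
    ← ENNReal.ofReal_rpow_of_nonneg dist_nonneg hr, ← edist_dist, ← edist_dist]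
  unfold truncatedQuotient
  gcongr
  exact min_le_right _ _

theorem tendsto_mul_measure_truncatedQuotient {X V : Type*} [MetricSpace X] [MeasurableSpace X]
    [PseudoMetricSpace V] {μ : Measure X} [SFinite μ] {q r : ℝ} (hq : 0 < q) (hr : 0 ≤ r)
    {Ω B : Set X} (hΩ : MeasurableSet Ω) (hB : MeasurableSet B) (hBΩ : B ⊆ Ω) {u v : X → V}
    (huv : u =ᵐ[μ.restrict Ω] v)
    (hlim : Tendsto (fun s : ℝ => ENNReal.ofReal s * (μ.prod μ)
      {p | p.1 ∈ Ω ∧ p.2 ∈ Ω ∧ s < dist (u p.1) (u p.2) ^ q / dist p.1 p.2 ^ r}) atTop (𝓝 0)) :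
    Tendsto (fun s : ℝ≥0 => s * ((μ.prod μ).restrict (B ×ˢ B))
      {p | s < truncatedQuotient v q r p}) atTop (𝓝 0) := by
  refine tendsto_of_tendsto_of_tendsto_of_le_of_le tendsto_const_nhds
    (hlim.comp (NNReal.tendsto_coe_atTop.2 tendsto_id)) (fun _ => zero_le) fun s => ?_
  have huv' : ∀ᵐ x ∂μ, x ∈ Ω → u x = v x := (ae_restrict_iff' hΩ).1 huv
  simp only [Function.comp_apply, id, ENNReal.ofReal_coe_nnreal]
  rw [Measure.restrict_apply' (hB.prod hB)]
  refine mul_le_mul_right (measure_mono_ae ?_) _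
  filter_upwards [Measure.quasiMeasurePreserving_fst.ae huv',
    Measure.quasiMeasurePreserving_snd.ae huv'] with p hp₁ hp₂
  rintro ⟨hs, hpB₁, hpB₂⟩
  refine ⟨hBΩ hpB₁, hBΩ hpB₂, ?_⟩
  rw [hp₁ (hBΩ hpB₁), hp₂ (hBΩ hpB₂)]
  have hlt := hs.trans_le (truncatedQuotient_le_ofReal v hq hr p)
  rwa [ENNReal.lt_ofReal_iff_toReal_lt ENNReal.coe_ne_top] at hlt

variable {E V : Type*} [SeminormedAddCommGroup E] [NormedSpace ℝ E] [PseudoEMetricSpace V]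

theorem truncatedQuotient_le_midpoint (v : E → V) {q r : ℝ} (hq : 1 ≤ q) (hr : 0 ≤ r) (x y : E) :
    truncatedQuotient v q r (x, y) ≤ 2 ^ (q - 1 - r) *
      (truncatedQuotient v q r (x, midpoint ℝ x y) +
        truncatedQuotient v q r (y, midpoint ℝ y x)) := by
  simp only [truncatedQuotient, edist_left_midpoint, edist_comm y x]
  rw [midpoint_comm y x]
  set z := midpoint ℝ x y
  set a := min 1 (edist (v x) (v z))
  set b := min 1 (edist (v y) (v z))
  have htriangle : min 1 (edist (v x) (v y)) ≤ a + b :=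
    (min_le_min_left 1 (edist_triangle_right _ _ _)).trans
      ((min_add_distrib _ _ _).trans_le (min_le_right _ _))
  have hhalf (c : ℝ≥0∞) : c / (edist x y / 2) ^ r = 2 ^ r * (c / edist x y ^ r) := by
    rw [ENNReal.div_rpow_of_nonneg _ _ hr, div_eq_mul_inv c,
      ENNReal.inv_div (.inl (by finiteness)) (.inl (by positivity))]
    simp only [div_eq_mul_inv]
    ring
  calc min 1 (edist (v x) (v y)) ^ q / edist x y ^ r
      ≤ (2 ^ (q - 1) * (a ^ q + b ^ q)) / edist x y ^ r := by
        gcongr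
        exact (ENNReal.rpow_le_rpow htriangle (by positivity)).trans
          (ENNReal.rpow_add_le_mul_rpow_add_rpow a b hq)
    _ = 2 ^ (q - 1 - r) * 2 ^ r * ((a ^ q + b ^ q) / edist x y ^ r) := by
        rw [← ENNReal.rpow_add _ _ two_ne_zero ENNReal.ofNat_ne_top, sub_add_cancel, mul_div_assoc]
    _ = 2 ^ (q - 1 - r) * (a ^ q / (edist x y / 2) ^ r + b ^ q / (edist x y / 2) ^ r) := by
        rw [hhalf, hhalf, ENNReal.add_div]
        ring

theorem indicator_truncatedQuotient_le_midpoint (v : E → V) {q r : ℝ} (hq : 1 ≤ q) (hr : 0 ≤ r)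
    {B : Set E} (hB : Convex ℝ B) (k : ℤ) (x y : E) :
    (dyadicShell B k).indicator (truncatedQuotient v q r) (x, y) ≤ 2 ^ (q - 1 - r) *
      ((dyadicShell B (k - 1)).indicator (truncatedQuotient v q r) (x, midpoint ℝ x y) +
        (dyadicShell B (k - 1)).indicator (truncatedQuotient v q r) (y, midpoint ℝ y x)) := by
  by_cases hxy : (x, y) ∈ dyadicShell B k
  · have hyx : (y, x) ∈ dyadicShell B k := swap_mem_dyadicShell.1 hxy
    rw [Set.indicator_of_mem hxy, Set.indicator_of_mem (midpoint_mem_dyadicShell hB hxy),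
      Set.indicator_of_mem (midpoint_mem_dyadicShell hB hyx)]
    exact truncatedQuotient_le_midpoint v hq hr x y
  · rw [Set.indicator_of_notMem hxy]
    exact zero_le

end TruncatedQuotient

section ShellIntegral

variable {E V : Type*} [NormedAddCommGroup E] [NormedSpace ℝ E] [FiniteDimensional ℝ E]
  [MeasurableSpace E] [BorelSpace E] [PseudoEMetricSpace V] (μ : Measure E) [μ.IsAddHaarMeasure]

theorem lintegral_comp_midpoint {g : E → ℝ≥0∞} (hg : Measurable g) (x : E) :
    ∫⁻ y, g (midpoint ℝ x y) ∂μ = 2 ^ finrank ℝ E * ∫⁻ z, g z ∂μ := by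
  have hshift : Measurable fun z => g ((2⁻¹ : ℝ) • x + z) := hg.comp (measurable_const_add _)
  have hjacobian : |((2⁻¹ : ℝ) ^ finrank ℝ E)⁻¹| = 2 ^ finrank ℝ E := by
    rw [inv_pow, inv_inv, abs_of_pos (by positivity)]
  simp only [midpoint_eq_smul_add, smul_add, invOf_eq_inv]
  rw [← lintegral_map hshift (measurable_const_smul (2⁻¹ : ℝ)),
    Measure.map_addHaar_smul μ (by norm_num), lintegral_smul_measure, hjacobian,
    lintegral_add_left_eq_self (μ := μ) g, ENNReal.ofReal_pow two_pos.le, ENNReal.ofReal_ofNat,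
    smul_eq_mul]

theorem measurable_prodMk_midpoint :
    Measurable fun p : E × E => (p.1, midpoint ℝ p.1 p.2) := by
  simp only [midpoint_eq_smul_add]
  fun_prop

theorem lintegral_prod_comp_midpoint {G : E × E → ℝ≥0∞} (hG : Measurable G) :
    ∫⁻ p, G (p.1, midpoint ℝ p.1 p.2) ∂(μ.prod μ) =
      2 ^ finrank ℝ E * ∫⁻ p, G p ∂(μ.prod μ) := by
  have hmid := hG.comp measurable_prodMk_midpoint
  calc ∫⁻ p, G (p.1, midpoint ℝ p.1 p.2) ∂(μ.prod μ)
      = ∫⁻ x, ∫⁻ y, G (x, midpoint ℝ x y) ∂μ ∂μ := lintegral_prod _ hmid.aemeasurable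
    _ = ∫⁻ x, 2 ^ finrank ℝ E * ∫⁻ z, G (x, z) ∂μ ∂μ :=
        lintegral_congr fun x => lintegral_comp_midpoint μ (hG.comp measurable_prodMk_left) x
    _ = 2 ^ finrank ℝ E * ∫⁻ p, G p ∂(μ.prod μ) := by
        rw [lintegral_const_mul _ hG.lintegral_prod_right', lintegral_prod _ hG.aemeasurable]

variable {v : E → V} {q r : ℝ} {B : Set E}

theorem setLIntegral_dyadicShell_le_mul (hv : StronglyMeasurable v) (hq : 1 ≤ q) (hr : 0 ≤ r)
    (hB : Convex ℝ B) (hBm : MeasurableSet B) (k : ℤ) :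
    ∫⁻ p in dyadicShell B k, truncatedQuotient v q r p ∂(μ.prod μ) ≤
      2 ^ (q + finrank ℝ E - r) *
        ∫⁻ p in dyadicShell B (k - 1), truncatedQuotient v q r p ∂(μ.prod μ) := by
  set G := (dyadicShell B (k - 1)).indicator (truncatedQuotient v q r)
  have hG : Measurable G :=
    (measurable_truncatedQuotient hv q r).indicator (measurableSet_dyadicShell hBm _)
  have hmid : Measurable fun p : E × E => G (p.1, midpoint ℝ p.1 p.2) :=
    hG.comp measurable_prodMk_midpoint
  have hswap : ∫⁻ p, G (p.2, midpoint ℝ p.2 p.1) ∂(μ.prod μ) =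
      ∫⁻ p, G (p.1, midpoint ℝ p.1 p.2) ∂(μ.prod μ) :=
    lintegral_prod_swap fun p : E × E => G (p.1, midpoint ℝ p.1 p.2)
  have hpow : (2 : ℝ≥0∞) ^ (q - 1 - r) * (2 * 2 ^ finrank ℝ E) = 2 ^ (q + finrank ℝ E - r) := by
    rw [← pow_succ', ← ENNReal.rpow_natCast,
      ← ENNReal.rpow_add _ _ two_ne_zero ENNReal.ofNat_ne_top]
    congr 1
    push_cast
    ring
  rw [← lintegral_indicator (measurableSet_dyadicShell hBm k),
    ← lintegral_indicator (measurableSet_dyadicShell hBm (k - 1))]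
  calc ∫⁻ p, (dyadicShell B k).indicator (truncatedQuotient v q r) p ∂(μ.prod μ)
      ≤ ∫⁻ p, 2 ^ (q - 1 - r) *
          (G (p.1, midpoint ℝ p.1 p.2) + G (p.2, midpoint ℝ p.2 p.1)) ∂(μ.prod μ) :=
        lintegral_mono fun p => indicator_truncatedQuotient_le_midpoint v hq hr hB k p.1 p.2
    _ = 2 ^ (q - 1 - r) * (2 * 2 ^ finrank ℝ E) * ∫⁻ p, G p ∂(μ.prod μ) := by
        rw [lintegral_const_mul' _ _ (by finiteness),
          lintegral_add_left hmid, hswap, lintegral_prod_comp_midpoint μ hG]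
        ring
    _ = 2 ^ (q + finrank ℝ E - r) * ∫⁻ p, G p ∂(μ.prod μ) := by rw [hpow]

theorem antitone_setLIntegral_dyadicShell (hv : StronglyMeasurable v) (hq : 1 ≤ q)
    (hB : Convex ℝ B) (hBm : MeasurableSet B) :
    Antitone fun k : ℤ =>
      ∫⁻ p in dyadicShell B k, truncatedQuotient v q (q + finrank ℝ E) p ∂(μ.prod μ) := by
  refine antitone_int_of_succ_le fun k => ?_
  simpa using setLIntegral_dyadicShell_le_mul μ hv hq (r := q + finrank ℝ E) (by positivity) hB hBm
    (k + 1)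

theorem nat_mul_setLIntegral_dyadicShell_le (hv : StronglyMeasurable v) (hq : 1 ≤ q)
    (hB : Convex ℝ B) (hBm : MeasurableSet B) (k : ℤ) (K : ℕ) {t : ℝ≥0∞}
    (ht : ((2 : ℝ≥0∞) ^ (K - k)) ^ (q + finrank ℝ E) ≤ t) :
    K * ∫⁻ p in dyadicShell B k, truncatedQuotient v q (q + finrank ℝ E) p ∂(μ.prod μ) ≤
      ∫⁻ p in B ×ˢ B ∩ {p | truncatedQuotient v q (q + finrank ℝ E) p ≤ t},
        truncatedQuotient v q (q + finrank ℝ E) p ∂(μ.prod μ) := by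
  set f := truncatedQuotient v q (q + finrank ℝ E)
  have hsublevel (j : ℕ) (hj : j ∈ Finset.range K) :
      dyadicShell B (k - j) ⊆ B ×ˢ B ∩ {p | f p ≤ t} := fun p hp => by
    refine ⟨hp.1, (truncatedQuotient_le_of_mem_dyadicShell v (by positivity) (by positivity)
      hp).trans (le_trans ?_ ht)⟩
    have hjK : j < K := Finset.mem_range.1 hj
    exact ENNReal.rpow_le_rpow (ENNReal.monotone_zpow one_le_two (by lia)) (by positivity)
  calc K * ∫⁻ p in dyadicShell B k, f p ∂(μ.prod μ)
      = ∑ _j ∈ Finset.range K, ∫⁻ p in dyadicShell B k, f p ∂(μ.prod μ) := by simp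
    _ ≤ ∑ j ∈ Finset.range K, ∫⁻ p in dyadicShell B (k - j), f p ∂(μ.prod μ) :=
        Finset.sum_le_sum fun j _ => antitone_setLIntegral_dyadicShell μ hv hq hB hBm (by lia)
    _ = ∫⁻ p in ⋃ j ∈ Finset.range K, dyadicShell B (k - j), f p ∂(μ.prod μ) :=
        (lintegral_biUnion_finset (t := fun j : ℕ => dyadicShell B (k - j))
          (fun i _ j _ hij => pairwise_disjoint_dyadicShell B (by simpa using hij))
          (fun j _ => measurableSet_dyadicShell hBm _) _).symm
    _ ≤ ∫⁻ p in B ×ˢ B ∩ {p | f p ≤ t}, f p ∂(μ.prod μ) :=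
        lintegral_mono_set (Set.iUnion₂_subset hsublevel)

theorem setLIntegral_dyadicShell_eq_zero (hv : StronglyMeasurable v) (hq : 1 ≤ q)
    (hB : Convex ℝ B) (hBm : MeasurableSet B) (hB_fin : μ B ≠ ∞)
    (hlim : Tendsto (fun s : ℝ≥0 => s * ((μ.prod μ).restrict (B ×ˢ B))
      {p | s < truncatedQuotient v q (q + finrank ℝ E) p}) atTop (𝓝 0)) (k : ℤ) :
    ∫⁻ p in dyadicShell B k, truncatedQuotient v q (q + finrank ℝ E) p ∂(μ.prod μ) = 0 := by
  have : IsFiniteMeasure ((μ.prod μ).restrict (B ×ˢ B)) :=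
    isFiniteMeasure_restrict.2 (by rw [Measure.prod_prod]; finiteness)
  set r := q + (finrank ℝ E : ℝ)
  have hr : 0 < r := by positivity
  have hf := measurable_truncatedQuotient hv q r
  have hlevel (K : ℕ) : ((2 : ℝ≥0∞) ^ (K - k)) ^ r =
      (((2 : ℝ≥0) ^ (-k)) ^ r * ((2 : ℝ≥0) ^ r) ^ K : ℝ≥0) := by
    rw [sub_eq_neg_add, ENNReal.zpow_add two_ne_zero ENNReal.ofNat_ne_top,
      ENNReal.mul_rpow_of_nonneg _ _ hr.le, zpow_natCast, ← ENNReal.rpow_natCast_mul,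
      mul_comm (K : ℝ), ENNReal.rpow_mul_natCast, ENNReal.coe_mul, ENNReal.coe_pow,
      ENNReal.coe_rpow_of_nonneg _ hr.le, ENNReal.coe_rpow_of_nonneg _ hr.le,
      ENNReal.coe_zpow two_ne_zero, ENNReal.coe_ofNat]
  have hsmall := tendsto_setLIntegral_sublevel_geometric_div_nat hf hlim
    (C := ((2 : ℝ≥0) ^ (-k)) ^ r) (b := 2 ^ r) (by positivity) (NNReal.one_lt_rpow one_lt_two hr)
  refine le_antisymm (ge_of_tendsto hsmall ?_) zero_le
  filter_upwards [eventually_gt_atTop 0] with K hK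
  rw [ENNReal.le_div_iff_mul_le (.inl (by positivity)) (.inl (by finiteness)), mul_comm,
    Measure.restrict_restrict (measurableSet_le hf measurable_const), Set.inter_comm]
  exact nat_mul_setLIntegral_dyadicShell_le μ hv hq hB hBm k K (hlevel K).le

end ShellIntegral

section Constancy

theorem exists_ae_eq_const_of_ae_prod_eq {α V : Type*} [MeasurableSpace α] [Nonempty V]
    {ν : Measure α} [SFinite ν] {v : α → V} (hv : ∀ᵐ p ∂(ν.prod ν), v p.1 = v p.2) :
    ∃ c, ∀ᵐ x ∂ν, v x = c := by
  rcases eq_or_ne ν 0 with rfl | hν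
  · exact ⟨Classical.arbitrary V, by simp⟩
  have : NeBot (ae ν) := ae_neBot.2 hν
  obtain ⟨x, hx⟩ := (Measure.ae_ae_of_ae_prod hv).exists
  exact ⟨v x, hx.mono fun _ hy => hy.symm⟩

theorem exists_ae_eq_const_of_locally {X V : Type*} [TopologicalSpace X]
    [SecondCountableTopology X] [MeasurableSpace X] [OpensMeasurableSpace X] [Nonempty V]
    {μ : Measure X} [μ.IsOpenPosMeasure] {Ω : Set X} (hΩ_open : IsOpen Ω)
    (hΩ_conn : IsPreconnected Ω) {u : X → V}
    (hu : ∀ x : Ω, ∃ W, IsOpen W ∧ ↑x ∈ W ∧ ∃ c, ∀ᵐ y ∂(μ.restrict W), u y = c) :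
    ∃ c, ∀ᵐ x ∂(μ.restrict Ω), u x = c := by
  choose W hW_open hxW c hc using hu
  have hc' (x : Ω) : ∀ᵐ y ∂μ, y ∈ W x → u y = c x :=
    (ae_restrict_iff' (hW_open x).measurableSet).1 (hc x)
  have hc_loc : IsLocallyConstant c := by
    refine (IsLocallyConstant.iff_exists_open c).2 fun x =>
      ⟨_, (hW_open x).preimage continuous_subtype_val, hxW x, fun y hy => ?_⟩
    have hpos : μ (W x ∩ W y) ≠ 0 :=
      ((hW_open x).inter (hW_open y)).measure_ne_zero μ ⟨y, hy, hxW y⟩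
    obtain ⟨z, ⟨hzx, hzy⟩, hcx, hcy⟩ :=
      ((frequently_ae_mem_iff.2 hpos).and_eventually ((hc' x).and (hc' y))).exists
    exact (hcy hzy).symm.trans (hcx hzx)
  rcases isEmpty_or_nonempty Ω with hΩ_empty | ⟨⟨x₀⟩⟩
  · exact ⟨Classical.arbitrary V, by simp [Set.isEmpty_coe_sort.1 hΩ_empty]⟩
  have : PreconnectedSpace Ω := Subtype.preconnectedSpace hΩ_conn
  obtain ⟨T, hT, hT_cover⟩ := TopologicalSpace.isOpen_iUnion_countable W hW_open
  refine ⟨c x₀, (ae_restrict_iff' hΩ_open.measurableSet).2 ?_⟩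
  filter_upwards [(ae_ball_iff hT).2 fun x _ => hc' x] with y hy hyΩ
  have hy_cover : y ∈ ⋃ x ∈ T, W x := hT_cover ▸ Set.mem_iUnion.2 ⟨⟨y, hyΩ⟩, hxW _⟩
  obtain ⟨x, hxT, hyx⟩ := Set.mem_iUnion₂.1 hy_cover
  rw [hy x hxT hyx, hc_loc.apply_eq_of_preconnectedSpace x x₀]

variable {E V : Type*} [NormedAddCommGroup E] [NormedSpace ℝ E] [FiniteDimensional ℝ E]
  [MeasurableSpace E] [BorelSpace E] [MetricSpace V] (μ : Measure E) [μ.IsAddHaarMeasure]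

theorem exists_ae_eq_const_of_tendsto_truncatedQuotient [Nonempty V] {v : E → V}
    (hv : StronglyMeasurable v) {q : ℝ} (hq : 1 ≤ q) {B : Set E} (hB : Convex ℝ B)
    (hBm : MeasurableSet B) (hB_fin : μ B ≠ ∞)
    (hlim : Tendsto (fun s : ℝ≥0 => s * ((μ.prod μ).restrict (B ×ˢ B))
      {p | s < truncatedQuotient v q (q + finrank ℝ E) p}) atTop (𝓝 0)) :
    ∃ c, ∀ᵐ x ∂(μ.restrict B), v x = c := by
  have hshell (k : ℤ) : ∀ᵐ p ∂(μ.prod μ), p ∈ dyadicShell B k → v p.1 = v p.2 := by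
    rw [← ae_restrict_iff' (measurableSet_dyadicShell hBm k)]
    filter_upwards [(lintegral_eq_zero_iff (measurable_truncatedQuotient hv q _)).1
      (setLIntegral_dyadicShell_eq_zero μ hv hq hB hBm hB_fin hlim k)] with p hp
    exact (truncatedQuotient_eq_zero_iff (by positivity) (by positivity)).1 hp
  refine exists_ae_eq_const_of_ae_prod_eq ?_
  rw [Measure.prod_restrict, ae_restrict_iff' (hBm.prod hBm)]
  filter_upwards [ae_all_iff.2 hshell] with p hp hpB
  by_contra hne
  obtain ⟨k, hk⟩ := exists_mem_dyadicShell hpB.1 hpB.2 (ne_of_apply_ne v hne)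
  exact hne (hp k hk)

end Constancy

theorem mainTheorem2_general {E V : Type*} [NormedAddCommGroup E] [NormedSpace ℝ E]
    [FiniteDimensional ℝ E] [MeasurableSpace E] [BorelSpace E] [MetricSpace V] (μ : Measure E)
    [μ.IsAddHaarMeasure] {Ω : Set E} (hΩ_open : IsOpen Ω) (hΩ_conn : IsPreconnected Ω) {q : ℝ}
    (hq : 1 ≤ q) {u : E → V} (hu : AEStronglyMeasurable u (μ.restrict Ω))
    (hlim : Tendsto (fun s : ℝ => ENNReal.ofReal s * (μ.prod μ)
      {p | p.1 ∈ Ω ∧ p.2 ∈ Ω ∧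
        s < dist (u p.1) (u p.2) ^ q / dist p.1 p.2 ^ (q + finrank ℝ E)}) atTop (𝓝 0)) :
    ∃ c, ∀ᵐ x ∂(μ.restrict Ω), u x = c := by
  have : Nonempty V := ⟨u 0⟩
  obtain ⟨v, hv, huv⟩ := hu
  refine exists_ae_eq_const_of_locally hΩ_open hΩ_conn fun ⟨x, hx⟩ => ?_
  obtain ⟨ρ, hρ, hball⟩ := Metric.isOpen_iff.1 hΩ_open x hx
  obtain ⟨c, hc⟩ := exists_ae_eq_const_of_tendsto_truncatedQuotient μ hv hq (convex_ball x ρ)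
    measurableSet_ball measure_ball_lt_top.ne
    (tendsto_mul_measure_truncatedQuotient (by positivity) (by positivity)
      hΩ_open.measurableSet measurableSet_ball hball huv hlim)
  refine ⟨Metric.ball x ρ, Metric.isOpen_ball, Metric.mem_ball_self hρ, c, ?_⟩
  filter_upwards [ae_restrict_of_ae_restrict_of_subset hball huv, hc] with y huy hvy
  exact huy.trans hvy

theorem mainTheorem2 (N m : ℕ) (Ω : Set (EuclideanSpace ℝ (Fin N)))
    (hΩ_open : IsOpen Ω) (hΩ_conn : IsPreconnected Ω) (q : ℝ) (hq : 1 ≤ q)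
    (u : EuclideanSpace ℝ (Fin N) → EuclideanSpace ℝ (Fin m))
    (hu : MemLp u (ENNReal.ofReal q) (volume.restrict Ω))
    (hlim : Tendsto
      (fun s : ℝ => ENNReal.ofReal s *
        (volume : Measure (EuclideanSpace ℝ (Fin N) × EuclideanSpace ℝ (Fin N)))
          {p | p.1 ∈ Ω ∧ p.2 ∈ Ω ∧
            s < ‖u p.2 - u p.1‖ ^ q / ‖p.2 - p.1‖ ^ (q + (N : ℝ))})
      atTop (𝓝 0)) :
    ∃ c : EuclideanSpace ℝ (Fin m), ∀ᵐ x ∂(volume.restrict Ω), u x = c :=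
  mainTheorem2_general volume hΩ_open hΩ_conn hq hu.aestronglyMeasurable <| by
    simpa only [dist_eq_norm', finrank_euclideanSpace_fin, Measure.volume_eq_prod] using hlim
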